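/- Let $[n]=\{1,\dots,n\}$ and equip the hypergrid $[n]^d$ with the coordinatewise partial order $\preceq$. For $f,g:[n]^d\to\{0,1\}$ let $\Delta(f,g)$ be the fraction of points of $[n]^d$ at which $f$ and $g$ differ, and let $\varepsilon_f=\min_{g\text{ monotone}}\Delta(f,g)$; call $f$ $\varepsilon$-far from monotone if $\varepsilon_f\ge\varepsilon$. A violation of $f$ is a pair of points $u\preceq v$ with $f(u)=1$ and $f(v)=0$. For $x\in[n]^d$ let $\Phi_f(x)$ be the number of dimensions $i\in\{1,\dots,d\}$ for which there is a point $y$ that differs from $x$ exactly in the $i$-th coordinate and forms a violation together with $x$ (as its lower or as its upper point). Theorem 1.1 (uncolored directed Talagrand inequality on the hypergrid). There is an absolute constant $c>0$ such that for all integers $n\ge 2$ and $d\ge 0$, every real $\varepsilon$, and every $f:[n]^d\to\{0,1\}$ that is $\varepsilon$-far from monotone, $$\mathbf{E}_{x\in[n]^d}\left[\sqrt{\Phi_f(x)}\right]\ \ge\ c\cdot\frac{\varepsilon}{\log n},$$ where $x$ is uniformly distributed on $[n]^d$ and $\log$ is the natural logarithm. -/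

import Mathlib

namespace Hypergrid

/-- The hypergrid `[n]^d`, with the coordinatewise order (`Fin n` stands for `{1, …, n}`). -/
abbrev Grid (n d : ℕ) : Type := Fin d → Fin n

/-- The expectation of a real quantity at a uniformly random point of the hypergrid. -/
noncomputable def expect {n d : ℕ} (F : Grid n d → ℝ) : ℝ :=
  (∑ x : Grid n d, F x) / (Fintype.card (Grid n d) : ℝ)

/-- The Hamming distance of two Boolean functions: the fraction of points where they differ. -/
noncomputable def relHammingDist {n d : ℕ} (f g : Grid n d → Bool) : ℝ :=
  ((Finset.univ.filter fun x : Grid n d => f x ≠ g x).card : ℝ) /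
    (Fintype.card (Grid n d) : ℝ)

/-- The distance to monotonicity: the minimum of `relHammingDist f g` over all monotone `g`
(the minimum exists, see `exists_monotone_distToMonotone`). -/
noncomputable def distToMonotone {n d : ℕ} (f : Grid n d → Bool) : ℝ :=
  ⨅ g : {g : Grid n d → Bool // Monotone g}, relHammingDist f g.1

theorem exists_monotone_distToMonotone {n d : ℕ} (f : Grid n d → Bool) :
    ∃ g : Grid n d → Bool, Monotone g ∧ relHammingDist f g = distToMonotone f := by
  have : Nonempty {g : Grid n d → Bool // Monotone g} := ⟨⟨fun _ => false, monotone_const⟩⟩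
  obtain ⟨g, hg⟩ := exists_eq_ciInf_of_finite
    (f := fun g : {g : Grid n d → Bool // Monotone g} => relHammingDist f g.1)
  exact ⟨g.1, g.2, hg⟩

/-- `f` is `ε`-far from monotone. -/
def IsFarFromMonotone {n d : ℕ} (ε : ℝ) (f : Grid n d → Bool) : Prop :=
  ε ≤ distToMonotone f

/-- `x` and `y` differ in the `i`-th coordinate and in no other one. -/
def Aligned {n d : ℕ} (i : Fin d) (x y : Grid n d) : Prop :=
  x i ≠ y i ∧ ∀ j, j ≠ i → x j = y j

/-- The unordered pair `{x, y}` violates the monotonicity of `f`. -/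
def Violation {n d : ℕ} (f : Grid n d → Bool) (x y : Grid n d) : Prop :=
  (x ≤ y ∧ f y < f x) ∨ (y ≤ x ∧ f x < f y)

open Classical in
/-- The thresholded influence of `x` along coordinate `i`. -/
noncomputable def influenceAlong {n d : ℕ} (f : Grid n d → Bool) (x : Grid n d) (i : Fin d) : ℕ :=
  if ∃ y : Grid n d, Aligned i x y ∧ Violation f x y then 1 else 0

/-- The thresholded influence of `x`: the number of dimensions in which `x` takes part in a
violation. -/
noncomputable def influence {n d : ℕ} (f : Grid n d → Bool) (x : Grid n d) : ℕ :=
  ∑ i : Fin d, influenceAlong f x i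

end Hypergrid

namespace Hypergrid

open Finset Function
open scoped BigOperators

/-! ### A two-sided Talagrand inequality on product spaces -/

/-! The bound holds with no logarithm: some function monotone along `A` differs from `f` in at most
`513 * talagrand A f` points (`talagrandBound`).

Fix `x` and let the set `S ⊆ A` of sorted dimensions vary. A potential argument
(`sum_sqrt_marked_append_le`) sorts one dimension at a time and bounds, for each `S`, the sum over
`x` of the square root of the number of `i ∈ A` whose flip in `S` changes the sorted value, by
`talagrand A f`. A two-sided Talagrand inequality over random `S`
(`mul_one_sub_le_expect_sqrt_sensitive`) then shows that sorting in two independent random sets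
gives nearly the same function.

Colour the dimensions with 16 colours. Any two colour classes sort `f` to nearby functions
(`expect_diffCard_le`), so sorting in one class and then in all of them costs little beyond the
first sort (`exists_monotoneAlong_biUnion`). That first sort is paid for by a bound with constant
`K` on a random class, whose Talagrand functional is on average at most a quarter of the original.
Hence `K` improves to `K / 2 + 256`; iterating from a trivial bound brings it below 513. -/

theorem sqrt_sq_add_sq_expect_le {σ : Type*} [Fintype σ] [Nonempty σ] (X Y : σ → ℝ) :
    √((𝔼 c, X c) ^ 2 + (𝔼 c, Y c) ^ 2) ≤ 𝔼 c, √(X c ^ 2 + Y c ^ 2) := by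
  set a := 𝔼 c, X c
  set b := 𝔼 c, Y c
  set r := √(a ^ 2 + b ^ 2) with hr
  have hr0 : 0 ≤ r := Real.sqrt_nonneg _
  have hr2 : r ^ 2 = a ^ 2 + b ^ 2 := Real.sq_sqrt (by positivity)
  rcases hr0.eq_or_lt with h0 | h0
  · rw [← h0]
    exact expect_nonneg fun c _ => Real.sqrt_nonneg _
  -- Cauchy–Schwarz against the mean vector `(a, b)`, pointwise in `c`.
  have key : 𝔼 c, (a * X c + b * Y c) ≤ 𝔼 c, r * √(X c ^ 2 + Y c ^ 2) := by
    refine expect_le_expect fun c _ => ?_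
    rw [hr, ← Real.sqrt_mul (by positivity)]
    refine Real.le_sqrt_of_sq_le ?_
    nlinarith [sq_nonneg (a * Y c - b * X c)]
  rw [expect_add_distrib, ← mul_expect, ← mul_expect, ← mul_expect] at key
  have : r * r ≤ r * 𝔼 c, √(X c ^ 2 + Y c ^ 2) := by
    refine le_trans (le_of_eq ?_) key
    rw [← sq, hr2, sq, sq]
  exact le_of_mul_le_mul_left this h0

/-- The value of `G` at `c` can be altered by changing the `i`-th coordinate of `c`. -/
def Sensitive {κ : Type*} {d : ℕ} (G : (Fin d → κ) → Bool) (i : Fin d) (c : Fin d → κ) : Prop :=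
  ∃ b, G (Function.update c i b) ≠ G c

theorem expect_fin_succ {κ : Type*} [Fintype κ] {d : ℕ} (F : (Fin (d + 1) → κ) → ℝ) :
    𝔼 c, F c = 𝔼 a, 𝔼 c : Fin d → κ, F (Fin.cons a c) := by
  rw [← Fintype.expect_equiv (Fin.consEquiv fun _ => κ) (fun p => F (Fin.cons p.1 p.2)) F
    (fun p => rfl), ← univ_product_univ, expect_product]

-- Induction on `d`, averaging over the first coordinate. Replacing the mean by slice means costs at
-- most `t ^ 2 / 2`, where `t` is the probability that the first coordinate matters; Minkowski
-- recovers this cost from the extra sensitive coordinate.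
open Classical in
theorem mul_one_sub_le_expect_sqrt_sensitive {κ : Type*} [Fintype κ] [Nonempty κ] {d : ℕ}
    (G : (Fin d → κ) → Bool) :
    (𝔼 c, if G c then (1 : ℝ) else 0) * (1 - 𝔼 c, if G c then (1 : ℝ) else 0) / 2 ≤
      𝔼 c, √(#{i | Sensitive G i c} : ℝ) := by
  induction d with
  | zero =>
    rw [univ_unique, expect_singleton]
    split_ifs <;> simp
  | succ d ih =>
    set m : κ → ℝ := fun a => 𝔼 c : Fin d → κ, if G (Fin.cons a c) then (1 : ℝ) else 0 with hm
    set D : (Fin d → κ) → Prop := fun c => ∃ a b, G (Fin.cons a c) ≠ G (Fin.cons b c) with hD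
    set t : ℝ := 𝔼 c : Fin d → κ, if D c then (1 : ℝ) else 0 with ht
    have ht0 : 0 ≤ t := expect_nonneg fun c _ => by positivity
    have ht1 : t ≤ 1 := by
      refine (expect_le_expect (g := fun _ => (1 : ℝ)) fun c _ => ?_).trans (by simp)
      split_ifs <;> norm_num
    have hm0 (a) : 0 ≤ m a := expect_nonneg fun c _ => by positivity
    have hm1 (a) : m a ≤ 1 := by
      refine (expect_le_expect (g := fun _ => (1 : ℝ)) fun c _ => ?_).trans (by simp)
      split_ifs <;> norm_num
    have hdiff (a b) : m a - m b ≤ t := by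
      rw [hm, ht]
      simp only
      rw [← expect_sub_distrib]
      refine expect_le_expect fun c _ => ?_
      by_cases h : D c
      · rw [if_pos h]
        split_ifs <;> norm_num
      · have : G (Fin.cons a c) = G (Fin.cons b c) := by
          by_contra hne
          exact h ⟨a, b, hne⟩
        simp [this, h]
    set M : ℝ := 𝔼 a, m a with hM
    have hmM (a) : (m a - M) ^ 2 ≤ t ^ 2 := by
      refine sq_le_sq' ?_ ?_
      · have : 𝔼 b : κ, (m b - m a) ≤ 𝔼 b : κ, t := expect_le_expect fun b _ => hdiff b a
        rw [expect_sub_distrib] at this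
        simp only [expect_const univ_nonempty] at this
        linarith
      · have : 𝔼 b : κ, (m a - m b) ≤ 𝔼 b : κ, t := expect_le_expect fun b _ => hdiff a b
        rw [expect_sub_distrib] at this
        simp only [expect_const univ_nonempty] at this
        linarith
    have hvar : M * (1 - M) / 2 ≤ 𝔼 a, (m a * (1 - m a) / 2 + t ^ 2 / 2) := by
      -- Exact second-order expansion of the quadratic around `M`; the linear term has mean zero.
      have e : M * (1 - M) / 2 =
          𝔼 a, (m a * (1 - m a) / 2 + ((m a - M) ^ 2 / 2 + (1 / 2 - M) * (M - m a))) := by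
        have : ∀ a, m a * (1 - m a) / 2 + ((m a - M) ^ 2 / 2 + (1 / 2 - M) * (M - m a)) =
            M * (1 - M) / 2 := fun a => by ring
        simp only [this, expect_const univ_nonempty]
      have z : 𝔼 a, (1 / 2 - M) * (M - m a) = 0 := by
        rw [← mul_expect, expect_sub_distrib, expect_const univ_nonempty, ← hM]
        ring
      rw [e, expect_add_distrib, expect_add_distrib, z, add_zero, ← expect_add_distrib]
      refine expect_le_expect fun a _ => ?_
      linarith [hmM a]
    rw [expect_fin_succ, expect_fin_succ fun c => √(#{i | Sensitive G i c} : ℝ)]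
    refine hvar.trans (expect_le_expect fun a _ => ?_)
    have hcard (c : Fin d → κ) : (#{i | Sensitive G i (Fin.cons a c)} : ℝ) =
        √(#{i | Sensitive (fun c => G (Fin.cons a c)) i c} : ℝ) ^ 2 +
          (if D c then (1 : ℝ) else 0) ^ 2 := by
      rw [Real.sq_sqrt (by positivity), Fin.card_filter_univ_succ]
      -- Sensitivity is two-sided: on a nonconstant line every point is sensitive, so the condition
      -- does not depend on `a`.
      have h0 : Sensitive G 0 (Fin.cons a c) ↔ D c := by
        simp only [Sensitive, Fin.update_cons_zero, hD]
        refine ⟨fun ⟨b, hb⟩ => ⟨b, a, hb⟩, fun ⟨b, b', hb⟩ => ?_⟩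
        by_contra! hc
        exact hb ((hc b).trans (hc b').symm)
      have h1 (i : Fin d) : Sensitive G i.succ (Fin.cons a c) ↔
          Sensitive (fun c => G (Fin.cons a c)) i c := by
        simp only [Sensitive, ← Fin.cons_update]
      by_cases h : D c <;> simp [h0, h, h1]
    simp only [hcard]
    refine le_trans ?_ (sqrt_sq_add_sq_expect_le _ _)
    refine le_trans ?_ (Real.sqrt_le_sqrt (add_le_add_left (pow_le_pow_left₀ ?_
      (ih fun c => G (Fin.cons a c)) 2) _))
    · change m a * (1 - m a) / 2 + t ^ 2 / 2 ≤ √((m a * (1 - m a) / 2) ^ 2 + t ^ 2)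
      refine Real.le_sqrt_of_sq_le ?_
      have hJ : m a * (1 - m a) / 2 ≤ 1 / 8 := by nlinarith [sq_nonneg (m a - 1 / 2)]
      have ht2 : t ^ 2 ≤ 1 := pow_le_one₀ ht0 ht1
      nlinarith [mul_le_mul_of_nonneg_right hJ (sq_nonneg t),
        mul_le_mul_of_nonneg_right ht2 (sq_nonneg t)]
    · change 0 ≤ m a * (1 - m a) / 2
      have := mul_nonneg (hm0 a) (sub_nonneg.2 (hm1 a))
      linarith

/-! ### Sorting a line -/

/-- The number of zeros of a Boolean function on a line. -/
def zeros {n : ℕ} (u : Fin n → Bool) : ℕ := #{a | u a = false}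

/-- The sorted rearrangement of a Boolean function on a line. -/
def lineSort {n : ℕ} (u : Fin n → Bool) (a : Fin n) : Bool := decide (zeros u ≤ a)

section Line

variable {n : ℕ} {u v : Fin n → Bool} {a b : Fin n}

theorem lineSort_eq_true : lineSort u a = true ↔ zeros u ≤ a := by simp [lineSort]

theorem lineSort_eq_false : lineSort u a = false ↔ (a : ℕ) < zeros u := by simp [lineSort]

theorem lineSort_monotone (u : Fin n → Bool) : Monotone (lineSort u) := by
  intro a b hab h
  rw [lineSort_eq_true] at h ⊢
  exact h.trans hab

theorem zeros_anti (h : u ≤ v) : zeros v ≤ zeros u := by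
  refine card_le_card fun a ha => ?_
  simp only [mem_filter, mem_univ, true_and] at ha ⊢
  have := h a
  rw [ha] at this
  exact Bool.eq_false_of_le_false this

theorem lineSort_mono (h : u ≤ v) : lineSort u ≤ lineSort v := by
  intro a ha
  rw [lineSort_eq_true] at ha ⊢
  exact (zeros_anti h).trans ha

theorem exists_zero_gt (hu : u a = true) (hs : lineSort u a = false) :
    ∃ b, a < b ∧ u b = false := by
  by_contra! hc
  rw [lineSort_eq_false] at hs
  have : zeros u ≤ #(Iio a) := card_le_card fun b hb => by
    simp only [mem_filter, mem_univ, true_and] at hb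
    rw [mem_Iio]
    by_contra! hab
    rcases hab.eq_or_lt with rfl | hlt
    · simp_all
    · exact hc b hlt hb
  rw [Fin.card_Iio] at this
  omega

theorem exists_one_lt (hu : u a = false) (hs : lineSort u a = true) :
    ∃ b, b < a ∧ u b = true := by
  by_contra! hc
  rw [lineSort_eq_true] at hs
  have : #(Iic a) ≤ zeros u := card_le_card fun b hb => by
    simp only [mem_filter, mem_univ, true_and]
    rw [mem_Iic] at hb
    rcases hb.eq_or_lt with rfl | hlt
    · exact hu
    · simpa using hc b hlt
  rw [Fin.card_Iic] at this
  omega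

theorem lineSort_of_monotone (h : Monotone u) : lineSort u = u := by
  funext a
  by_contra hne
  rcases hu : u a with _ | _
  · obtain ⟨b, hb, hb'⟩ := exists_one_lt hu (by simpa [hu] using hne)
    have := h hb.le
    rw [hu, hb'] at this
    exact absurd this (by decide)
  · obtain ⟨b, hb, hb'⟩ := exists_zero_gt hu (by simpa [hu] using hne)
    have := h hb.le
    rw [hu, hb'] at this
    exact absurd this (by decide)

theorem zeros_le_add (u v : Fin n → Bool) :
    zeros v ≤ zeros u + #{a | u a = true ∧ v a = false} := by
  unfold zeros
  refine le_trans (card_le_card fun a ha => ?_) (card_union_le _ _)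
  simp only [mem_filter, mem_univ, true_and, mem_union] at ha ⊢
  rcases u a with _ | _ <;> simp [ha]

/-- Sorted lines disagree only between their two thresholds, and the gap between the zero counts is
at most the original number of disagreements. -/
theorem card_lineSort_ne_le (u v : Fin n → Bool) :
    #{a | lineSort u a ≠ lineSort v a} ≤ #{a | u a ≠ v a} := by
  wlog h : zeros u ≤ zeros v generalizing u v
  · simpa [ne_comm] using this v u (by omega)
  have h1 : #{a | u a = true ∧ v a = false} ≤ #{a | u a ≠ v a} :=
    card_le_card fun a ha => by
      simp only [mem_filter, mem_univ, true_and] at ha ⊢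
      simp [ha]
  have h2 : #{a | lineSort u a ≠ lineSort v a} ≤ #(Ico (zeros u) (zeros v)) := by
    refine card_le_card_of_injOn Fin.val (fun a ha => ?_) Fin.val_injective.injOn
    simp only [coe_filter, mem_univ, true_and, Set.mem_ofPred_eq, lineSort, ne_eq,
      decide_eq_decide] at ha
    simp only [coe_Ico, Set.mem_Ico]
    omega
  rw [Nat.card_Ico] at h2
  have := zeros_le_add u v
  omega

end Line

/-! ### Rearrangement of indicator sums -/

/-- Concavity of the square root: marginal gains shrink as the multiplicity grows. -/
theorem sqrt_add_one_sub_sqrt_anti {m M : ℕ} (h : m ≤ M) :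
    √((M : ℝ) + 1) - √M ≤ √((m : ℝ) + 1) - √m := by
  have hm : (0 : ℝ) ≤ m := m.cast_nonneg
  have hM : (m : ℝ) ≤ M := by exact_mod_cast h
  have e (t : ℝ) (ht : 0 ≤ t) : √(t + 1) - √t = 1 / (√(t + 1) + √t) := by
    have h1 : 0 < √(t + 1) := Real.sqrt_pos.2 (by linarith)
    have h2 := Real.sqrt_nonneg t
    rw [eq_div_iff (by positivity)]
    have := Real.sq_sqrt ht
    have := Real.sq_sqrt (show 0 ≤ t + 1 by linarith)
    nlinarith
  rw [e _ hm, e _ (hm.trans hM)]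
  have h1 : 0 < √((m : ℝ) + 1) := Real.sqrt_pos.2 (by linarith)
  gcongr

open Classical in
/-- Among families of sets with bounded cardinalities, initial segments minimise the sum of the
square roots of the multiplicities. -/
theorem sum_sqrt_card_le_of_initial {ι π : Type*} (A : Finset ι) (P P' : Finset π) (r : π → ℕ)
    (hr : Set.InjOn r P') (B B' : ι → π → Prop)
    (h : ∀ i ∈ A, ∀ p ∈ P', B' i p → r p < #{p ∈ P | B i p}) :
    ∑ p ∈ P', √(#{i ∈ A | B' i p} : ℝ) ≤ ∑ p ∈ P, √(#{i ∈ A | B i p} : ℝ) := by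
  set s : ι → ℕ := fun i => #{p ∈ P | B i p} with hs
  suffices H : ∑ p ∈ P', √(#{i ∈ A | r p < s i} : ℝ) ≤ ∑ p ∈ P, √(#{i ∈ A | B i p} : ℝ) by
    refine le_trans (sum_le_sum fun p hp => Real.sqrt_le_sqrt ?_) H
    refine Nat.cast_le.2 (card_le_card fun i hi => ?_)
    rw [mem_filter] at hi ⊢
    exact ⟨hi.1, h i hi.1 p hp hi.2⟩
  clear h
  -- The set inserted last is the smallest. Its initial segment lies inside all the others, so there
  -- each marginal gain is exactly `δ`, the least possible; on the unsorted side the gain is at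
  -- least `δ`.
  induction A using Finset.induction_on_min_value s with
  | empty => simp
  | insert i A hi hmin ih =>
    set δ : ℝ := √((#A : ℝ) + 1) - √(#A : ℝ) with hδ
    have hδ0 : 0 ≤ δ := sub_nonneg.2 (Real.sqrt_le_sqrt (by linarith))
    have hupper : ∑ p ∈ P', √(#{j ∈ insert i A | r p < s j} : ℝ) ≤
        ∑ p ∈ P', (√(#{j ∈ A | r p < s j} : ℝ) + if r p < s i then δ else 0) := by
      refine sum_le_sum fun p _ => ?_
      rw [filter_insert]
      split_ifs with hp
      · have : {j ∈ A | r p < s j} = A := filter_true_of_mem fun j hj => hp.trans_le (hmin j hj)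
        rw [this, card_insert_of_notMem hi]
        push_cast
        linarith
      · simp
    have hlower : ∑ p ∈ P, (√(#{j ∈ A | B j p} : ℝ) + if B i p then δ else 0) ≤
        ∑ p ∈ P, √(#{j ∈ insert i A | B j p} : ℝ) := by
      refine sum_le_sum fun p _ => ?_
      rw [filter_insert]
      split_ifs with hp
      · rw [card_insert_of_notMem (by simp [hi])]
        push_cast
        have := sqrt_add_one_sub_sqrt_anti (card_filter_le A (fun j => B j p))
        linarith
      · simp
    refine hupper.trans (le_trans ?_ hlower)
    rw [sum_add_distrib, sum_add_distrib, ← sum_filter, ← sum_filter, sum_const, sum_const,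
      nsmul_eq_mul, nsmul_eq_mul]
    refine add_le_add ih (mul_le_mul_of_nonneg_right (Nat.cast_le.2 ?_) hδ0)
    calc #{p ∈ P' | r p < s i} ≤ #(range (s i)) :=
          card_le_card_of_injOn r (fun p hp => by simpa using (by simpa using hp : p ∈ P' ∧ _).2)
            (hr.mono fun p hp => (mem_filter.1 (mem_coe.1 hp)).1)
      _ = s i := card_range _

open Classical in
/-- If sorting a line turns each set of marked points into a set that lies, on either side of the
threshold, in an initial segment no longer than the original set, then the sum of the square
roots of the multiplicities does not increase. -/
theorem sum_sqrt_card_le_of_lineSort {ι : Type*} {n : ℕ} (A : Finset ι) (u : Fin n → Bool)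
    (B B' : ι → Fin n → Prop)
    (h1 : ∀ i ∈ A, ∀ a, lineSort u a = true → B' i a →
      (a : ℕ) < zeros u + #{b | u b = true ∧ B i b})
    (h0 : ∀ i ∈ A, ∀ a, lineSort u a = false → B' i a →
      zeros u ≤ (a : ℕ) + #{b | u b = false ∧ B i b}) :
    ∑ a, √(#{i ∈ A | B' i a} : ℝ) ≤ ∑ a, √(#{i ∈ A | B i a} : ℝ) := by
  have split (w : Fin n → Bool) (F : Fin n → ℝ) :
      ∑ a, F a = ∑ a with w a = true, F a + ∑ a with w a = false, F a := by
    rw [← sum_filter_add_sum_filter_not univ (fun a => w a = true)]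
    simp
  rw [split (lineSort u), split u]
  refine add_le_add ?_ ?_
  · refine sum_sqrt_card_le_of_initial A _ _ (fun a : Fin n => (a : ℕ) - zeros u) ?_ B B' ?_
    · intro a ha b hb hab
      simp only [coe_filter, mem_univ, true_and, Set.mem_ofPred_eq, lineSort_eq_true] at ha hb
      simp only at hab
      omega
    · intro i hi a ha hB
      simp only [mem_filter, mem_univ, true_and] at ha
      have := h1 i hi a ha hB
      rw [lineSort_eq_true] at ha
      rw [filter_filter]
      omega
  -- Ranks count away from the threshold on both sides; the `- 1` gives rank 0 to the zero just
  -- below it.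
  · refine sum_sqrt_card_le_of_initial A _ _ (fun a : Fin n => zeros u - 1 - (a : ℕ)) ?_ B B' ?_
    · intro a ha b hb hab
      simp only [coe_filter, mem_univ, true_and, Set.mem_ofPred_eq, lineSort_eq_false] at ha hb
      simp only at hab
      omega
    · intro i hi a ha hB
      simp only [mem_filter, mem_univ, true_and] at ha
      have := h0 i hi a ha hB
      rw [lineSort_eq_false] at ha
      rw [filter_filter]
      omega

section Grid

variable {n d : ℕ}

/-! ### Sorting along the dimensions of the hypergrid -/

/-- The restriction of `f` to the axis-parallel line through `x` in dimension `i`. -/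
def line (f : Grid n d → Bool) (i : Fin d) (x : Grid n d) (a : Fin n) : Bool := f (update x i a)

/-- The function obtained from `f` by sorting every line in dimension `i`. -/
def sortDim (i : Fin d) (f : Grid n d → Bool) (x : Grid n d) : Bool := lineSort (line f i x) (x i)

/-- Sort in those dimensions of the list that belong to `S`, in the order of the list. -/
def sortAlong (S : Finset (Fin d)) (l : List (Fin d)) (f : Grid n d → Bool) : Grid n d → Bool :=
  l.foldl (fun h j => if j ∈ S then sortDim j h else h) f

/-- The function obtained from `f` by sorting in the dimensions of `S`, in increasing order. -/
def sortSet (S : Finset (Fin d)) (f : Grid n d → Bool) : Grid n d → Bool :=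
  sortAlong S (List.finRange d) f

/-- `f` is monotone in each of the dimensions of `S`. -/
def MonotoneAlong (S : Finset (Fin d)) (f : Grid n d → Bool) : Prop :=
  ∀ i ∈ S, ∀ x, Monotone (line f i x)

/-- The number of points at which `f` and `g` differ. -/
def diffCard (f g : Grid n d → Bool) : ℕ := #{x | f x ≠ g x}

theorem line_update_self (f : Grid n d → Bool) (i : Fin d) (x : Grid n d) (a : Fin n) :
    line f i (update x i a) = line f i x := by
  funext b
  simp [line]

theorem line_update_of_ne (f : Grid n d → Bool) {i j : Fin d} (h : i ≠ j) (x : Grid n d)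
    (a b : Fin n) : line f i (update x j a) b = line f j (update x i b) a := by
  simp [line, update_comm h]

theorem line_sortDim (f : Grid n d → Bool) (i : Fin d) (x : Grid n d) :
    line (sortDim i f) i x = lineSort (line f i x) := by
  funext a
  change lineSort (line f i (update x i a)) (update x i a i) = _
  rw [line_update_self, update_self]

theorem sum_sum_update {M : Type*} [AddCommMonoid M] (i : Fin d) (F : Grid n d → M) :
    ∑ x, ∑ a, F (update x i a) = n • ∑ x, F x := by
  -- Exchanging `a` with the `i`-th coordinate is an involution on the pairs.
  let e : Grid n d × Fin n → Grid n d × Fin n := fun p => (update p.1 i p.2, p.1 i)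
  have he : Involutive e := fun p => by simp [e]
  calc ∑ x, ∑ a, F (update x i a) = ∑ p : Grid n d × Fin n, F (e p).1 :=
        (Fintype.sum_prod_type fun p : Grid n d × Fin n => F (e p).1).symm
    _ = ∑ p : Grid n d × Fin n, F p.1 :=
        Equiv.sum_comp (he.toPerm e) fun p : Grid n d × Fin n => F p.1
    _ = n • ∑ x, F x := by
        rw [Fintype.sum_prod_type]
        simp [sum_nsmul]

theorem sum_le_sum_of_line {R : Type*} [Semiring R] [LinearOrder R] [IsStrictOrderedRing R]
    (i : Fin d) {F G : Grid n d → R}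
    (h : ∀ x, ∑ a, F (update x i a) ≤ ∑ a, G (update x i a)) : ∑ x, F x ≤ ∑ x, G x := by
  rcases Nat.eq_zero_or_pos n with rfl | hn
  · have : IsEmpty (Grid 0 d) := ⟨fun x => (x i).elim0⟩
    simp
  · have := sum_le_sum fun x (_ : x ∈ univ) => h x
    rw [sum_sum_update, sum_sum_update, nsmul_eq_mul, nsmul_eq_mul] at this
    exact le_of_mul_le_mul_left this (by exact_mod_cast hn)

theorem diffCard_eq_sum (f g : Grid n d → Bool) :
    diffCard f g = ∑ x, if f x ≠ g x then 1 else 0 := card_filter _ _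

theorem diffCard_comm (f g : Grid n d → Bool) : diffCard f g = diffCard g f := by
  simp [diffCard, ne_comm]

theorem diffCard_triangle (f g h : Grid n d → Bool) :
    diffCard f h ≤ diffCard f g + diffCard g h := by
  refine le_trans (card_le_card fun x hx => ?_) (card_union_le _ _)
  simp only [mem_filter, mem_univ, true_and, mem_union] at hx ⊢
  by_contra! hc
  exact hx (hc.1.trans hc.2)

theorem diffCard_sortDim_le (i : Fin d) (f g : Grid n d → Bool) :
    diffCard (sortDim i f) (sortDim i g) ≤ diffCard f g := by
  rw [diffCard_eq_sum, diffCard_eq_sum]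
  refine sum_le_sum_of_line i fun x => ?_
  have := card_lineSort_ne_le (line f i x) (line g i x)
  rw [← line_sortDim, ← line_sortDim, card_filter, card_filter] at this
  exact this

/-- Sorting lines in dimension `j` preserves the pointwise order between parallel lines, hence
monotonicity in the other dimensions. -/
theorem MonotoneAlong.sortDim {S : Finset (Fin d)} {f : Grid n d → Bool} (hf : MonotoneAlong S f)
    (j : Fin d) : MonotoneAlong (insert j S) (sortDim j f) := by
  intro i hi x
  by_cases hij : i = j
  · subst hij
    rw [line_sortDim]
    exact lineSort_monotone _
  · have hiS : i ∈ S := (mem_insert.1 hi).resolve_left hij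
    intro a b hab
    change lineSort (line f j (update x i a)) (update x i a j) ≤
      lineSort (line f j (update x i b)) (update x i b j)
    rw [update_of_ne (Ne.symm hij), update_of_ne (Ne.symm hij)]
    refine lineSort_mono (fun c => ?_) _
    rw [line_update_of_ne f (Ne.symm hij), line_update_of_ne f (Ne.symm hij)]
    exact hf i hiS _ hab

theorem MonotoneAlong.sortDim_eq {S : Finset (Fin d)} {f : Grid n d → Bool}
    (hf : MonotoneAlong S f) {i : Fin d} (hi : i ∈ S) : Hypergrid.sortDim i f = f := by
  funext x
  rw [Hypergrid.sortDim, lineSort_of_monotone (hf i hi x), line, update_eq_self]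

theorem MonotoneAlong.mono {S T : Finset (Fin d)} {f : Grid n d → Bool} (hf : MonotoneAlong T f)
    (h : S ⊆ T) : MonotoneAlong S f := fun i hi => hf i (h hi)

theorem sortAlong_append_singleton (S : Finset (Fin d)) (l : List (Fin d)) (j : Fin d)
    (f : Grid n d → Bool) : sortAlong S (l ++ [j]) f =
      if j ∈ S then sortDim j (sortAlong S l f) else sortAlong S l f := by
  simp [sortAlong]

theorem sortAlong_congr {S T : Finset (Fin d)} {l : List (Fin d)} (h : ∀ j ∈ l, j ∈ S ↔ j ∈ T)
    (f : Grid n d → Bool) : sortAlong S l f = sortAlong T l f := by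
  refine List.foldl_ext _ _ _ fun g j hj => ?_
  simp [h j hj]

theorem diffCard_sortAlong_le (S : Finset (Fin d)) (l : List (Fin d)) (f g : Grid n d → Bool) :
    diffCard (sortAlong S l f) (sortAlong S l g) ≤ diffCard f g := by
  induction l using List.reverseRecOn with
  | nil => exact le_rfl
  | append_singleton l j ih =>
    rw [sortAlong_append_singleton, sortAlong_append_singleton]
    split_ifs
    · exact (diffCard_sortDim_le _ _ _).trans ih
    · exact ih

theorem diffCard_sortSet_le (S : Finset (Fin d)) (f g : Grid n d → Bool) :
    diffCard (sortSet S f) (sortSet S g) ≤ diffCard f g := diffCard_sortAlong_le _ _ _ _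

theorem MonotoneAlong.sortAlong {S : Finset (Fin d)} {f : Grid n d → Bool}
    (hf : MonotoneAlong S f) (T : Finset (Fin d)) (l : List (Fin d)) :
    MonotoneAlong (S ∪ {j ∈ T | j ∈ l}) (sortAlong T l f) := by
  induction l using List.reverseRecOn with
  | nil => simpa [Hypergrid.sortAlong] using hf
  | append_singleton l j ih =>
    rw [sortAlong_append_singleton]
    split_ifs with hj
    · refine (ih.sortDim j).mono fun k hk => ?_
      simp only [mem_union, mem_filter, mem_insert, List.mem_append, List.mem_singleton] at hk ⊢
      tauto
    · refine ih.mono fun k hk => ?_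
      simp only [mem_union, mem_filter, List.mem_append, List.mem_singleton] at hk ⊢
      rcases hk with hk | ⟨hk, hk' | rfl⟩
      · exact Or.inl hk
      · exact Or.inr ⟨hk, hk'⟩
      · exact absurd hk hj

theorem MonotoneAlong.sortSet {S : Finset (Fin d)} {f : Grid n d → Bool}
    (hf : MonotoneAlong S f) (T : Finset (Fin d)) : MonotoneAlong (S ∪ T) (sortSet T f) := by
  simpa [Hypergrid.sortSet] using hf.sortAlong T (List.finRange d)

theorem monotoneAlong_empty (f : Grid n d → Bool) : MonotoneAlong ∅ f := fun i hi => by simp at hi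

theorem monotoneAlong_sortSet (S : Finset (Fin d)) (f : Grid n d → Bool) :
    MonotoneAlong S (sortSet S f) := by
  simpa using (monotoneAlong_empty f).sortSet S

theorem MonotoneAlong.sortSet_eq {S : Finset (Fin d)} {f : Grid n d → Bool}
    (hf : MonotoneAlong S f) : Hypergrid.sortSet S f = f := by
  unfold Hypergrid.sortSet
  induction List.finRange d using List.reverseRecOn with
  | nil => rfl
  | append_singleton l j ih =>
    rw [sortAlong_append_singleton, ih]
    split_ifs with hj
    · exact hf.sortDim_eq hj
    · rfl

theorem MonotoneAlong.monotone {f : Grid n d → Bool} (hf : MonotoneAlong univ f) : Monotone f := by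
  intro x y hxy
  suffices H : ∀ s : Finset (Fin d), f x ≤ f (s.piecewise y x) by simpa using H univ
  intro s
  induction s using Finset.induction_on with
  | empty => simp
  | insert i s hi ih =>
    refine ih.trans ?_
    rw [piecewise_insert]
    have := hf i (mem_univ i) (s.piecewise y x) (hxy i)
    have e : update (s.piecewise y x) i (x i) = s.piecewise y x := by
      rw [update_eq_self_iff, piecewise_eq_of_notMem _ _ _ hi]
    rwa [line, line, e] at this

/-! ### Violations and the effect of sorting -/

/-- `x` takes part in a violation of `f` in dimension `i`. -/
def Violated (f : Grid n d → Bool) (i : Fin d) (x : Grid n d) : Prop :=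
  (f x = true ∧ ∃ b, x i < b ∧ line f i x b = false) ∨
    (f x = false ∧ ∃ b, b < x i ∧ line f i x b = true)

open Classical in
/-- The sum over all points of the square root of the number of dimensions of `A` in which the
point takes part in a violation. -/
noncomputable def talagrand (A : Finset (Fin d)) (f : Grid n d → Bool) : ℝ :=
  ∑ x, √(#{i ∈ A | Violated f i x} : ℝ)

theorem violated_of_sortDim_ne {f : Grid n d → Bool} {i : Fin d} {x : Grid n d}
    (h : f x ≠ sortDim i f x) : Violated f i x := by
  have e : line f i x (x i) = f x := by simp [line]
  rcases hx : f x with _ | _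
  · exact Or.inr ⟨hx, exists_one_lt (e.trans hx) (by simpa [hx, sortDim] using h.symm)⟩
  · exact Or.inl ⟨hx, exists_zero_gt (e.trans hx) (by simpa [hx, sortDim] using h.symm)⟩

/-- The part of the potential at `x` contributed by dimension `i` while the dimensions of `S` are
being sorted: before dimension `i` is reached it records whether `x` is violated in that
dimension, afterwards it records whether the value at `x` depends on the membership of `i`
in `S`. -/
def Marked (S : Finset (Fin d)) (f : Grid n d → Bool) (l : List (Fin d)) (i : Fin d)
    (x : Grid n d) : Prop :=
  if i ∈ l then sortAlong S l f x ≠ sortAlong (symmDiff S {i}) l f x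
  else Violated (sortAlong S l f) i x

theorem mem_symmDiff_singleton_of_ne {S : Finset (Fin d)} {i j : Fin d} (h : j ≠ i) :
    j ∈ symmDiff S {i} ↔ j ∈ S := by
  simp [mem_symmDiff, h]

theorem mem_symmDiff_singleton_self {S : Finset (Fin d)} {i : Fin d} :
    i ∈ symmDiff S {i} ↔ i ∉ S := by
  simp [mem_symmDiff]

/-! ### Counting marked points on a line -/

section LineBounds

variable {u v : Fin n → Bool} {a : Fin n} {P : Fin n → Prop} [DecidablePred P]

theorem lt_zeros_add_card_of_lineSort (hv : lineSort v a = false)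
    (h : ∀ b, u b = true → v b = false → P b) : (a : ℕ) < zeros u + #{b | u b = true ∧ P b} := by
  rw [lineSort_eq_false] at hv
  refine (hv.trans_le (zeros_le_add u v)).trans_le (Nat.add_le_add_left (card_le_card ?_) _)
  exact monotone_filter_right _ fun b _ hb => ⟨hb.1, h b hb.1 hb.2⟩

theorem zeros_le_add_card_of_lineSort (hv : lineSort v a = true)
    (h : ∀ b, u b = false → v b = true → P b) : zeros u ≤ a + #{b | u b = false ∧ P b} := by
  rw [lineSort_eq_true] at hv
  refine ((zeros_le_add v u).trans (Nat.add_le_add_right hv _)).trans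
    (Nat.add_le_add_left (card_le_card ?_) _)
  exact monotone_filter_right _ fun b _ hb => ⟨hb.2, h b hb.2 hb.1⟩

theorem lt_zeros_add_card_of_eq_false (hu : u a = false) (h : ∀ b < a, u b = true → P b) :
    (a : ℕ) < zeros u + #{b | u b = true ∧ P b} := by
  have : #(Iic a) ≤ zeros u + #{b | u b = true ∧ P b} := by
    refine le_trans (card_le_card fun b hb => ?_) (card_union_le _ _)
    rw [mem_Iic] at hb
    rcases hub : u b with _ | _
    · simp [hub]
    · have hlt : b < a := lt_of_le_of_ne hb (by rintro rfl; simp [hu] at hub)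
      simp [hub, h b hlt hub]
  rw [Fin.card_Iic] at this
  omega

theorem zeros_le_add_card_of_eq_true (hu : u a = true) (h : ∀ b, a < b → u b = false → P b) :
    zeros u ≤ a + #{b | u b = false ∧ P b} := by
  rw [← Fin.card_Iio a]
  refine le_trans (card_le_card fun b hb => ?_) (card_union_le _ _)
  simp only [mem_filter, mem_univ, true_and] at hb
  rcases lt_trichotomy b a with hlt | rfl | hlt
  · simp [hlt]
  · simp [hu] at hb
  · simp [hb, h b hlt hb]

end LineBounds

theorem violated_update_self {f : Grid n d → Bool} {i : Fin d} {x : Grid n d} {a : Fin n} :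
    Violated f i (update x i a) ↔
      (line f i x a = true ∧ ∃ b, a < b ∧ line f i x b = false) ∨
        (line f i x a = false ∧ ∃ b, b < a ∧ line f i x b = true) := by
  simp only [Violated, line_update_self, update_self]
  rfl

theorem violated_update_of_ne {f : Grid n d → Bool} {i j : Fin d} (h : i ≠ j) {x : Grid n d}
    {a : Fin n} : Violated f i (update x j a) ↔
      (line f j x a = true ∧ ∃ b, x i < b ∧ line f j (update x i b) a = false) ∨
        (line f j x a = false ∧ ∃ b, b < x i ∧ line f j (update x i b) a = true) := by
  simp only [Violated, line_update_of_ne f h, update_of_ne h]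
  rfl

/-! ### One sorting step does not increase the potential -/

section Step

variable {S : Finset (Fin d)} {f : Grid n d → Bool} {l : List (Fin d)} {i j : Fin d}

theorem sortAlong_symmDiff_self (hj : j ∉ l) :
    sortAlong (symmDiff S {j}) l f = sortAlong S l f :=
  sortAlong_congr (fun k hk => mem_symmDiff_singleton_of_ne (by rintro rfl; exact hj hk)) f

/-- Nothing is sorted here; only the meaning of the mark of `j` changes, from being violated to
being altered by a sort, which is stronger. -/
theorem Marked.of_append_of_notMem (hj : j ∉ l) (hjS : j ∉ S) {x : Grid n d}
    (h : Marked S f (l ++ [j]) i x) : Marked S f l i x := by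
  unfold Marked at h ⊢
  rw [sortAlong_append_singleton, sortAlong_append_singleton, if_neg hjS] at h
  by_cases hij : i = j
  · subst hij
    rw [if_pos (by simp), if_pos (mem_symmDiff_singleton_self.2 hjS),
      sortAlong_symmDiff_self hj] at h
    rw [if_neg hj]
    exact violated_of_sortDim_ne h
  · rw [if_neg (mt (mem_symmDiff_singleton_of_ne (Ne.symm hij)).1 hjS)] at h
    simpa [hij] using h

section Marks

variable {x : Grid n d} {a : Fin n}

theorem marked_self (hj : j ∉ l) : Marked S f l j (update x j a) ↔
    (line (sortAlong S l f) j x a = true ∧ ∃ b, a < b ∧ line (sortAlong S l f) j x b = false) ∨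
      (line (sortAlong S l f) j x a = false ∧
        ∃ b, b < a ∧ line (sortAlong S l f) j x b = true) := by
  rw [Marked, if_neg hj, violated_update_self]

theorem marked_of_mem (hi : i ∈ l) : Marked S f l i (update x j a) ↔
    line (sortAlong S l f) j x a ≠ line (sortAlong (symmDiff S {i}) l f) j x a := by
  rw [Marked, if_pos hi]
  rfl

theorem marked_of_notMem (hij : i ≠ j) (hi : i ∉ l) : Marked S f l i (update x j a) ↔
    (line (sortAlong S l f) j x a = true ∧
      ∃ b, x i < b ∧ line (sortAlong S l f) j (update x i b) a = false) ∨
    (line (sortAlong S l f) j x a = false ∧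
      ∃ b, b < x i ∧ line (sortAlong S l f) j (update x i b) a = true) := by
  rw [Marked, if_neg hi, violated_update_of_ne hij]

theorem marked_append_self (hj : j ∉ l) (hjS : j ∈ S) : Marked S f (l ++ [j]) j (update x j a) ↔
    line (sortDim j (sortAlong S l f)) j x a ≠ line (sortAlong S l f) j x a := by
  rw [marked_of_mem (by simp), sortAlong_append_singleton, sortAlong_append_singleton, if_pos hjS,
    if_neg (by simpa [mem_symmDiff_singleton_self] using hjS), sortAlong_symmDiff_self hj]

theorem marked_append_of_mem (hjS : j ∈ S) (hij : i ≠ j) (hi : i ∈ l) :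
    Marked S f (l ++ [j]) i (update x j a) ↔ line (sortDim j (sortAlong S l f)) j x a ≠
      line (sortDim j (sortAlong (symmDiff S {i}) l f)) j x a := by
  rw [marked_of_mem (by simp [hi]), sortAlong_append_singleton, sortAlong_append_singleton,
    if_pos hjS, if_pos ((mem_symmDiff_singleton_of_ne hij.symm).2 hjS)]

theorem marked_append_of_notMem (hjS : j ∈ S) (hij : i ≠ j) (hi : i ∉ l) :
    Marked S f (l ++ [j]) i (update x j a) ↔
      (line (sortDim j (sortAlong S l f)) j x a = true ∧
        ∃ b, x i < b ∧ line (sortDim j (sortAlong S l f)) j (update x i b) a = false) ∨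
      (line (sortDim j (sortAlong S l f)) j x a = false ∧
        ∃ b, b < x i ∧ line (sortDim j (sortAlong S l f)) j (update x i b) a = true) := by
  rw [marked_of_notMem hij (by simp [hi, hij]), sortAlong_append_singleton, if_pos hjS]

end Marks

-- On each line in dimension `j` the rearrangement lemma applies: a mark at `a` after sorting forces
-- enough marks before it. For `i = j` a misplaced value is violated by all opposite values on its
-- wrong side; for `i ≠ j` one compares zero counts with a second line, from the flipped set if `i ∈
-- l` and parallel in dimension `i` otherwise.
open Classical in
theorem sum_sqrt_marked_append_le (A : Finset (Fin d)) (hj : j ∉ l) :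
    ∑ x, √(#{i ∈ A | Marked S f (l ++ [j]) i x} : ℝ) ≤ ∑ x, √(#{i ∈ A | Marked S f l i x} : ℝ) := by
  by_cases hjS : j ∈ S
  swap
  · refine sum_le_sum fun x _ => Real.sqrt_le_sqrt (Nat.cast_le.2 (card_le_card ?_))
    exact fun i hi => mem_filter.2 ⟨(mem_filter.1 hi).1, (mem_filter.1 hi).2.of_append_of_notMem hj hjS⟩
  refine sum_le_sum_of_line j fun x => ?_
  set u := line (sortAlong S l f) j x with hu
  refine sum_sqrt_card_le_of_lineSort A u (fun i a => Marked S f l i (update x j a))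
    (fun i a => Marked S f (l ++ [j]) i (update x j a)) ?_ ?_
  · intro i _ a ha hB
    rcases eq_or_ne i j with rfl | hij
    · rw [marked_append_self hj hjS, line_sortDim, ← hu, ha] at hB
      refine lt_zeros_add_card_of_eq_false (by simpa using hB) fun b hb hub => ?_
      rw [marked_self hj]
      exact Or.inl ⟨hub, a, hb, by simpa using hB⟩
    by_cases hil : i ∈ l
    · rw [marked_append_of_mem hjS hij hil, line_sortDim, line_sortDim, ← hu, ha] at hB
      refine lt_zeros_add_card_of_lineSort (by simpa using hB) fun b hub hvb => ?_
      rw [marked_of_mem hil, ← hu, hub, hvb]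
      decide
    · rw [marked_append_of_notMem hjS hij hil, line_sortDim, ← hu, ha] at hB
      obtain ⟨-, b, hb, hvb⟩ := hB.resolve_right (by simp)
      rw [line_sortDim] at hvb
      refine lt_zeros_add_card_of_lineSort hvb fun c huc hvc => ?_
      rw [marked_of_notMem hij hil]
      exact Or.inl ⟨huc, b, hb, hvc⟩
  · intro i _ a ha hB
    rcases eq_or_ne i j with rfl | hij
    · rw [marked_append_self hj hjS, line_sortDim, ← hu, ha] at hB
      refine zeros_le_add_card_of_eq_true (by simpa using hB) fun b hb hub => ?_
      rw [marked_self hj]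
      exact Or.inr ⟨hub, a, hb, by simpa using hB⟩
    by_cases hil : i ∈ l
    · rw [marked_append_of_mem hjS hij hil, line_sortDim, line_sortDim, ← hu, ha] at hB
      refine zeros_le_add_card_of_lineSort (by simpa using hB) fun b hub hvb => ?_
      rw [marked_of_mem hil, ← hu, hub, hvb]
      decide
    · rw [marked_append_of_notMem hjS hij hil, line_sortDim, ← hu, ha] at hB
      obtain ⟨-, b, hb, hvb⟩ := hB.resolve_left (by simp)
      rw [line_sortDim] at hvb
      refine zeros_le_add_card_of_lineSort hvb fun c huc hvc => ?_
      rw [marked_of_notMem hij hil]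
      exact Or.inr ⟨huc, b, hb, hvc⟩

end Step

open Classical in
theorem sum_sqrt_sortSet_ne_le (A S : Finset (Fin d)) (f : Grid n d → Bool) :
    ∑ x, √(#{i ∈ A | sortSet S f x ≠ sortSet (symmDiff S {i}) f x} : ℝ) ≤ talagrand A f := by
  -- For the empty list the marks are the violations of `f`; for the full list they record
  -- sensitivity to `S`.
  have H : ∀ l : List (Fin d), l.Nodup →
      ∑ x, √(#{i ∈ A | Marked S f l i x} : ℝ) ≤ talagrand A f := by
    intro l
    induction l using List.reverseRecOn with
    | nil => intro _; simp [Marked, talagrand, sortAlong]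
    | append_singleton l j ih =>
      intro hl
      rw [List.nodup_append] at hl
      refine (sum_sqrt_marked_append_le A fun hj => ?_).trans (ih hl.1)
      exact hl.2.2 j hj j (by simp) rfl
  refine le_trans (le_of_eq ?_) (H (List.finRange d) (List.nodup_finRange d))
  refine sum_congr rfl fun x _ => ?_
  congr! 4
  simp [Marked, sortSet]

/-! ### Random sets of dimensions -/

/-- The dimensions of `A` that receive the colour `m`. -/
def colorClass {k : ℕ} (A : Finset (Fin d)) (m : Fin k) (c : Fin d → Fin k) : Finset (Fin d) :=
  {i ∈ A | c i = m}

theorem colorClass_update {k : ℕ} (A : Finset (Fin d)) (m : Fin k) (c : Fin d → Fin k)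
    (i : Fin d) (b : Fin k) :
    colorClass A m (update c i b) = colorClass A m c ∨
      (i ∈ A ∧ colorClass A m (update c i b) = symmDiff (colorClass A m c) {i}) := by
  by_cases h : i ∈ A ∧ ¬(b = m ↔ c i = m)
  · refine Or.inr ⟨h.1, ?_⟩
    ext j
    rcases eq_or_ne j i with rfl | hj
    · rw [mem_symmDiff_singleton_self]
      simp only [colorClass, mem_filter, update_self]
      tauto
    · rw [mem_symmDiff_singleton_of_ne hj]
      simp [colorClass, hj]
  · refine Or.inl ?_
    ext j
    rcases eq_or_ne j i with rfl | hj
    · simp only [colorClass, mem_filter, update_self]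
      tauto
    · simp [colorClass, hj]

open Classical in
theorem expect_sqrt_sensitive_le {k : ℕ} [NeZero k] (A : Finset (Fin d)) (m : Fin k)
    (f : Grid n d → Bool) :
    ∑ x, 𝔼 c, √(#{i | Sensitive (fun c => sortSet (colorClass A m c) f x) i c} : ℝ) ≤
      talagrand A f := by
  rw [← expect_sum_comm]
  refine expect_le univ_nonempty fun c _ => ?_
  refine le_trans (sum_le_sum fun x _ => Real.sqrt_le_sqrt (Nat.cast_le.2 (card_le_card ?_)))
    (sum_sqrt_sortSet_ne_le A (colorClass A m c) f)
  intro i hi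
  obtain ⟨b, hb⟩ := (mem_filter.1 hi).2
  beta_reduce at hb
  rcases colorClass_update A m c i b with h | ⟨hA, h⟩
  · rw [h] at hb
    exact absurd rfl hb
  · rw [h] at hb
    exact mem_filter.2 ⟨hA, hb.symm⟩

/-- The probability that two independent copies of a random bit differ. -/
theorem expect_expect_ne {σ : Type*} [Fintype σ] [Nonempty σ] (G : σ → Bool) :
    𝔼 c, 𝔼 c', (if G c ≠ G c' then (1 : ℝ) else 0) =
      2 * ((𝔼 c, if G c then (1 : ℝ) else 0) * (1 - 𝔼 c, if G c then (1 : ℝ) else 0)) := by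
  set χ : σ → ℝ := fun c => if G c then (1 : ℝ) else 0 with hχ
  have e (c c') : (if G c ≠ G c' then (1 : ℝ) else 0) =
      χ c * (1 - χ c') + (1 - χ c) * χ c' := by
    simp only [hχ]
    rcases G c <;> rcases G c' <;> simp
  simp only [e, expect_add_distrib, ← mul_expect, ← expect_mul, expect_sub_distrib,
    expect_const univ_nonempty]
  ring

/-- At each point the disagreement probability is `2p(1 - p)`, at most four times the expected root
of the sensitivity. -/
theorem expect_expect_diffCard_le {k : ℕ} [NeZero k] (A : Finset (Fin d)) (m : Fin k)
    (f : Grid n d → Bool) :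
    𝔼 c, 𝔼 c', (diffCard (sortSet (colorClass A m c) f) (sortSet (colorClass A m c') f) : ℝ) ≤
      4 * talagrand A f := by
  classical
  have e : 𝔼 c, 𝔼 c',
      (diffCard (sortSet (colorClass A m c) f) (sortSet (colorClass A m c') f) : ℝ) =
      ∑ x, 𝔼 c, 𝔼 c', if sortSet (colorClass A m c) f x ≠ sortSet (colorClass A m c') f x
        then (1 : ℝ) else 0 := by
    simp only [diffCard_eq_sum, Nat.cast_sum, Nat.cast_ite, Nat.cast_one, Nat.cast_zero]
    rw [← expect_sum_comm]
    exact expect_congr rfl fun c _ => expect_sum_comm _ _ _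
  rw [e]
  calc _ ≤ ∑ x, 4 * 𝔼 c, √(#{i | Sensitive (fun c => sortSet (colorClass A m c) f x) i c} : ℝ) := by
        refine sum_le_sum fun x _ => ?_
        rw [expect_expect_ne fun c => sortSet (colorClass A m c) f x]
        have := mul_one_sub_le_expect_sqrt_sensitive fun c => sortSet (colorClass A m c) f x
        linarith
    _ ≤ 4 * talagrand A f := by
        rw [← mul_sum]
        exact mul_le_mul_of_nonneg_left (expect_sqrt_sensitive_le A m f) (by norm_num)

theorem expect_comp_perm {k : ℕ} (m m' : Fin k) (A : Finset (Fin d))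
    (F : Finset (Fin d) → ℝ) :
    𝔼 c, F (colorClass A m c) = 𝔼 c, F (colorClass A m' c) := by
  refine Fintype.expect_equiv (Equiv.piCongrRight fun _ => Equiv.swap m m') _ _ fun c => ?_
  congr 1
  ext i
  simp [colorClass, Equiv.swap_apply_eq_iff]

/-- Classes of one colouring are dependent, so an independent colouring `c'` is inserted: both are
compared with its class `m`, and colours are exchangeable. -/
theorem expect_diffCard_le {k : ℕ} [NeZero k] (A : Finset (Fin d)) (m m' : Fin k)
    (f : Grid n d → Bool) :
    𝔼 c, (diffCard (sortSet (colorClass A m c) f) (sortSet (colorClass A m' c) f) : ℝ) ≤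
      8 * talagrand A f := by
  have h := expect_expect_diffCard_le A m f
  have h1 : 𝔼 c, (diffCard (sortSet (colorClass A m c) f) (sortSet (colorClass A m' c) f) : ℝ) ≤
      𝔼 c, 𝔼 c', ((diffCard (sortSet (colorClass A m c) f) (sortSet (colorClass A m c') f) : ℝ) +
        diffCard (sortSet (colorClass A m' c) f) (sortSet (colorClass A m c') f)) := by
    refine expect_le_expect fun c _ => le_expect univ_nonempty fun c' _ => ?_
    rw [diffCard_comm (sortSet (colorClass A m' c) f)]
    exact_mod_cast diffCard_triangle _ _ _
  simp only [expect_add_distrib] at h1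
  rw [expect_comp_perm m' m A fun S =>
    𝔼 c', (diffCard (sortSet S f) (sortSet (colorClass A m c') f) : ℝ)] at h1
  linarith

theorem expect_sqrt_le_sqrt_expect {σ : Type*} [Fintype σ] [Nonempty σ] (X : σ → ℝ)
    (hX : ∀ c, 0 ≤ X c) : 𝔼 c, √(X c) ≤ √(𝔼 c, X c) := by
  refine Real.le_sqrt_of_sq_le ?_
  set μ := 𝔼 c, √(X c) with hμ
  have h : 0 ≤ 𝔼 c, (X c + (μ ^ 2 - 2 * μ * √(X c))) := expect_nonneg fun c _ => by
    nlinarith [sq_nonneg (√(X c) - μ), Real.sq_sqrt (hX c)]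
  rw [expect_add_distrib, expect_sub_distrib, ← mul_expect, ← hμ,
    expect_const univ_nonempty] at h
  linarith

/-- Each violated dimension survives with probability `1 / k`; Jensen moves the expectation under
the root. -/
theorem expect_talagrand_colorClass_le {k : ℕ} [NeZero k] (A : Finset (Fin d)) (m : Fin k)
    (f : Grid n d → Bool) : 𝔼 c, talagrand (colorClass A m c) f ≤ talagrand A f / √k := by
  classical
  unfold talagrand
  rw [expect_sum_comm, sum_div]
  refine sum_le_sum fun x _ => (expect_sqrt_le_sqrt_expect _ fun c => Nat.cast_nonneg _).trans ?_
  rw [← Real.sqrt_div (Nat.cast_nonneg _)]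
  refine Real.sqrt_le_sqrt (le_of_eq ?_)
  have hi (i : Fin d) : 𝔼 c : Fin d → Fin k, (if c i = m then (1 : ℝ) else 0) = 1 / k := by
    have h1 (m' : Fin k) : 𝔼 c : Fin d → Fin k, (if c i = m then (1 : ℝ) else 0) =
        𝔼 c : Fin d → Fin k, (if c i = m' then (1 : ℝ) else 0) := by
      refine Fintype.expect_equiv (Equiv.piCongrRight fun _ => Equiv.swap m m') _ _ fun c => ?_
      simp [Equiv.swap_apply_eq_iff]
    have h2 : ∑ m' : Fin k, 𝔼 c : Fin d → Fin k, (if c i = m' then (1 : ℝ) else 0) = 1 := by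
      rw [← expect_sum_comm]
      simp [expect_const univ_nonempty]
    simp only [← h1, sum_const, card_univ, Fintype.card_fin, nsmul_eq_mul] at h2
    have : (k : ℝ) ≠ 0 := NeZero.ne _
    field_simp
    linarith
  have hc (c : Fin d → Fin k) : (#{i ∈ colorClass A m c | Violated f i x} : ℝ) =
      ∑ i ∈ A with Violated f i x, if c i = m then (1 : ℝ) else 0 := by
    rw [sum_boole, filter_filter, colorClass, filter_filter]
    simp only [and_comm]
  simp only [hc]
  rw [expect_sum_comm]
  simp only [hi, sum_const, nsmul_eq_mul]
  ring

/-! ### The distance to monotonicity -/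

/-- Sorting fixes `g` and is a contraction, so `sortSet S f` is as close to `g` as `f` is. -/
theorem diffCard_sortSet_self_le {S : Finset (Fin d)} {f g : Grid n d → Bool}
    (hg : MonotoneAlong S g) : diffCard f (sortSet S f) ≤ 2 * diffCard f g := by
  have h1 := diffCard_triangle f g (sortSet S f)
  have h2 := diffCard_sortSet_le S g f
  rw [hg.sortSet_eq, diffCard_comm g f] at h2
  omega

theorem exists_monotoneAlong_biUnion {ι : Type*} [DecidableEq ι] (S₀ : Finset (Fin d))
    (S : ι → Finset (Fin d)) (s : Finset ι) (f : Grid n d → Bool) :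
    ∃ g, MonotoneAlong (S₀ ∪ s.biUnion S) g ∧
      diffCard (sortSet S₀ f) g ≤ ∑ m ∈ s, 2 * diffCard (sortSet S₀ f) (sortSet (S m) f) := by
  induction s using Finset.induction_on with
  | empty => exact ⟨sortSet S₀ f, by simpa using monotoneAlong_sortSet S₀ f, by simp [diffCard]⟩
  | insert m s hm ih =>
    obtain ⟨g, hg, hd⟩ := ih
    refine ⟨sortSet (S m) g, (hg.sortSet (S m)).mono ?_, ?_⟩
    · rw [biUnion_insert]
      intro i hi
      simp only [mem_union] at hi ⊢
      tauto
    · rw [sum_insert hm]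
      -- Every step is measured from `sortSet S₀ f`; since `sortSet (S m)` is an idempotent
      -- contraction, errors add up instead of doubling.
      have h1 := diffCard_triangle (sortSet S₀ f) (sortSet (S m) f) (sortSet (S m) g)
      have h2 := diffCard_triangle (sortSet (S m) f) (sortSet (S m) (sortSet S₀ f))
        (sortSet (S m) g)
      have h3 := diffCard_sortSet_le (S m) (sortSet S₀ f) g
      have h4 := diffCard_sortSet_le (S m) (sortSet (S m) f) (sortSet S₀ f)
      rw [(monotoneAlong_sortSet (S m) f).sortSet_eq, diffCard_comm _ (sortSet S₀ f)] at h4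
      omega

theorem biUnion_colorClass {k : ℕ} (A : Finset (Fin d)) (c : Fin d → Fin k) :
    univ.biUnion (fun m => colorClass A m c) = A := by
  ext i
  simp [colorClass]

/-! ### Improving the constant by iteration -/

/-- Every function can be made monotone along any set of dimensions by changing at most `K` times
its Talagrand functional many values. -/
def TalagrandBound (n d : ℕ) (K : ℝ) : Prop :=
  ∀ (A : Finset (Fin d)) (f : Grid n d → Bool),
    ∃ g, MonotoneAlong A g ∧ (diffCard f g : ℝ) ≤ K * talagrand A f

theorem talagrand_nonneg (A : Finset (Fin d)) (f : Grid n d → Bool) : 0 ≤ talagrand A f :=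
  sum_nonneg fun _ _ => Real.sqrt_nonneg _

theorem TalagrandBound.mono {K L : ℝ} (h : TalagrandBound n d K) (hKL : K ≤ L) :
    TalagrandBound n d L := fun A f =>
  let ⟨g, hg, hd⟩ := h A f
  ⟨g, hg, hd.trans (mul_le_mul_of_nonneg_right hKL (talagrand_nonneg A f))⟩

theorem talagrandBound_card : TalagrandBound n d (Fintype.card (Grid n d)) := by
  classical
  intro A f
  by_cases h : ∃ x, ∃ i ∈ A, Violated f i x
  · obtain ⟨x, i, hi, hx⟩ := h
    refine ⟨fun _ => false, fun i _ x => monotone_const, ?_⟩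
    have h1 : (1 : ℝ) ≤ talagrand A f := by
      refine le_trans ?_ (single_le_sum (fun x _ => Real.sqrt_nonneg _) (mem_univ x))
      rw [Real.one_le_sqrt, Nat.one_le_cast, Nat.succ_le_iff, card_pos]
      exact ⟨i, mem_filter.2 ⟨hi, hx⟩⟩
    have h2 : (diffCard f fun _ => false : ℝ) ≤ Fintype.card (Grid n d) := by
      exact_mod_cast card_filter_le _ _
    exact h2.trans (le_mul_of_one_le_right (Nat.cast_nonneg _) h1)
  · refine ⟨f, fun i hi x a b hab hfa => ?_, ?_⟩
    · by_contra hfb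
      refine h ⟨update x i a, i, hi, violated_update_self.2 (Or.inl ⟨hfa, b, ?_, ?_⟩)⟩
      · exact lt_of_le_of_ne hab (by rintro rfl; exact hfb hfa)
      · simpa using hfb
    · simpa only [diffCard, ne_eq, not_true, filter_false, card_empty, Nat.cast_zero] using
        mul_nonneg (Nat.cast_nonneg _) (talagrand_nonneg A f)

theorem TalagrandBound.step {K : ℝ} (hK : 0 ≤ K) (h : TalagrandBound n d K) :
    TalagrandBound n d (K / 2 + 256) := by
  intro A f
  let S (m : Fin 16) (c : Fin d → Fin 16) := colorClass A m c
  -- Mean cost: `2 * K / √16 = K / 2` for the first sort and `16 * 2 * 8 = 256` for the rest. Some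
  -- colouring does no worse than the mean.
  let X (c : Fin d → Fin 16) : ℝ := 2 * (K * talagrand (S 0 c) f) +
    ∑ m, 2 * (diffCard (sortSet (S 0 c) f) (sortSet (S m c) f) : ℝ)
  have hX : 𝔼 c, X c ≤ (K / 2 + 256) * talagrand A f := by
    have h16 : √((16 : ℕ) : ℝ) = 4 := by
      rw [show ((16 : ℕ) : ℝ) = 4 ^ 2 by norm_num, Real.sqrt_sq (by norm_num)]
    have h1 := expect_talagrand_colorClass_le A (0 : Fin 16) f
    rw [h16] at h1
    have h2 : ∑ m : Fin 16, 2 * 𝔼 c, (diffCard (sortSet (S 0 c) f) (sortSet (S m c) f) : ℝ) ≤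
        ∑ m : Fin 16, 2 * (8 * talagrand A f) := sum_le_sum fun m _ =>
      mul_le_mul_of_nonneg_left (expect_diffCard_le A 0 m f) (by norm_num)
    simp only [X, expect_add_distrib, expect_sum_comm, ← mul_expect]
    simp only [sum_const, card_univ, Fintype.card_fin, nsmul_eq_mul] at h2
    have h3 := mul_le_mul_of_nonneg_left h1 hK
    push_cast at h2
    linarith
  obtain ⟨c, -, hc⟩ := exists_le_of_expect_le univ_nonempty hX
  obtain ⟨g₀, hg₀, hd₀⟩ := h (S 0 c) f
  obtain ⟨g, hg, hd⟩ := exists_monotoneAlong_biUnion (S 0 c) (fun m => S m c) univ f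
  refine ⟨g, hg.mono ?_, le_trans ?_ hc⟩
  · rw [biUnion_colorClass]
    exact subset_union_right
  · have h1 := diffCard_triangle f (sortSet (S 0 c) f) g
    have h2 := diffCard_sortSet_self_le (f := f) hg₀
    have h3 : (diffCard f g : ℝ) ≤ 2 * diffCard f g₀ +
        ∑ m, 2 * (diffCard (sortSet (S 0 c) f) (sortSet (S m c) f) : ℝ) := by
      exact_mod_cast h1.trans (add_le_add h2 hd)
    simp only [X]
    linarith

theorem talagrandBound : TalagrandBound n d 513 := by
  -- 512 is the fixed point of `K ↦ K / 2 + 256`; the excess halves each round until it is at most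
  -- 1.
  have H (m : ℕ) : TalagrandBound n d ((Fintype.card (Grid n d) : ℝ) / 2 ^ m + 512) := by
    induction m with
    | zero => exact talagrandBound_card.mono (by simp)
    | succ m ih =>
      refine (ih.step (by positivity)).mono (le_of_eq ?_)
      rw [pow_succ]
      ring
  refine (H (Fintype.card (Grid n d))).mono ?_
  have : (Fintype.card (Grid n d) : ℝ) / 2 ^ Fintype.card (Grid n d) ≤ 1 := by
    rw [div_le_one (by positivity)]
    exact_mod_cast Nat.lt_two_pow_self.le
  linarith

theorem card_violated_le_influence [∀ (f : Grid n d → Bool) x, DecidablePred (Violated f · x)]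
    (f : Grid n d → Bool) (x : Grid n d) : #{i | Violated f i x} ≤ influence f x := by
  rw [card_filter, influence]
  refine sum_le_sum fun i _ => ?_
  split_ifs with h
  swap
  · exact Nat.zero_le _
  have aligned {b : Fin n} (hb : x i ≠ b) : Aligned i x (update x i b) :=
    ⟨by simpa using hb, fun j hj => by simp [hj]⟩
  rw [influenceAlong, if_pos]
  rcases h with ⟨hx, b, hb, hfb⟩ | ⟨hx, b, hb, hfb⟩
  · refine ⟨update x i b, aligned hb.ne, Or.inl ⟨le_update_self_iff.2 hb.le, ?_⟩⟩
    rw [hx, show f (update x i b) = false from hfb]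
    decide
  · refine ⟨update x i b, aligned hb.ne', Or.inr ⟨update_le_self_iff.2 hb.le, ?_⟩⟩
    rw [hx, show f (update x i b) = true from hfb]
    decide

/-- The directed Talagrand inequality on the hypergrid. -/
theorem distToMonotone_le (f : Grid n d → Bool) :
    distToMonotone f ≤ 513 * expect fun x => √(influence f x : ℝ) := by
  classical
  obtain ⟨g, hg, hd⟩ := talagrandBound univ f
  have h1 : distToMonotone f ≤ relHammingDist f g :=
    ciInf_le (f := fun g : {g : Grid n d → Bool // Monotone g} => relHammingDist f g.1)
      (Set.finite_range _).bddBelow ⟨g, hg.monotone⟩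
  refine h1.trans ?_
  rw [expect, ← mul_div_assoc]
  refine div_le_div_of_nonneg_right (hd.trans ?_) (Nat.cast_nonneg _)
  refine mul_le_mul_of_nonneg_left (sum_le_sum fun x _ => Real.sqrt_le_sqrt ?_) (by norm_num)
  exact_mod_cast card_violated_le_influence f x

end Grid

end Hypergrid

theorem theorem1p1 :
    ∃ c : ℝ, 0 < c ∧
      ∀ (n d : ℕ), 2 ≤ n → ∀ (f : Hypergrid.Grid n d → Bool) (ε : ℝ),
        Hypergrid.IsFarFromMonotone ε f →
          c * (ε / Real.log (n : ℝ)) ≤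
            Hypergrid.expect fun x => Real.sqrt (Hypergrid.influence f x : ℝ) := by
  have hlog2 : 0 < Real.log 2 := Real.log_pos (by norm_num)
  -- The logarithm only weakens the bound; `log 2` covers the smallest case `n = 2`.
  refine ⟨Real.log 2 / 513, by positivity, fun n d hn f ε hε => ?_⟩
  have hlog : Real.log 2 ≤ Real.log n := Real.log_le_log (by norm_num) (by exact_mod_cast hn)
  have hlogn : 0 < Real.log n := hlog2.trans_le hlog
  have hE : 0 ≤ Hypergrid.expect fun x => Real.sqrt (Hypergrid.influence f x : ℝ) :=
    div_nonneg (Finset.sum_nonneg fun _ _ => Real.sqrt_nonneg _) (Nat.cast_nonneg _)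
  have hmain := le_trans hε (Hypergrid.distToMonotone_le f)
  rw [← mul_div_assoc, div_le_iff₀ hlogn]
  have h1 := mul_le_mul_of_nonneg_left hmain hlog2.le
  have h2 := mul_le_mul_of_nonneg_left hlog hE
  linarith
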